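/- Turing machines are deterministic, $M=(Q,\Sigma,\Gamma,\delta,q_0,q_{\mathrm{accept}},q_{\mathrm{reject}})$ with finite sets $Q,\Sigma,\Gamma$, a blank symbol $\sqcup\in\Gamma$, $\Sigma\subseteq\Gamma\setminus\{\sqcup\}$, $\delta:Q\times\Gamma\to Q\times\Gamma\times\{\mathrm L,\mathrm R\}$ and $q_{\mathrm{accept}}\ne q_{\mathrm{reject}}$. The tape is one-way infinite, and a head that tries to move left from the first cell stays in place. A configuration is a triple $(q,w,i)$ of a state $q\in Q$, tape contents $w\in\Gamma^{\mathbb N}$ and a head position $i\in\mathbb N$. On an input word $x$ over $\Sigma$ the machine starts in state $q_0$ with the head on the first cell and $x$ followed by blanks on the tape, and it halts when it enters $q_{\mathrm{accept}}$ or $q_{\mathrm{reject}}$. The trajectory of $M$ on $x$ is the (finite or infinite) sequence $c_0,c_1,\dots$ of configurations that occur when $M$ is run on $x$. It is eventually periodic if the machine returns to a previously visited configuration, that is, if $c_s=c_t$ for some $s<t$; in particular, it is not eventually periodic if $M$ halts on $x$. After numbering the elements of its three sets, so that $Q=\{0,\dots,n-1\}$, and $\Sigma$ and $\Gamma$ are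 numbered by $\{0,\dots,k-1\}$ and $\{0,\dots,m-1\}$, a machine $M$ with an input $x$ is given by the list of the natural numbers $n,k,m,q_0,q_{\mathrm{accept}},q_{\mathrm{reject}},\sqcup$, the numbers in $\Gamma$ of the letters of $\Sigma$, the transition table (for each state $q$ and, within it, each symbol $a$, the new state, the symbol written, and $0$ for $\mathrm L$ or $1$ for $\mathrm R$), and the letters of $x$. Let $\langle M,x\rangle\in\{0,1\}^*$ be the binary word obtained from this list by writing each number $j$ as $1^j0$. This encoding is injective. **Theorem 1.1.** There is no algorithm that decides, given a Turing machine $M$ and an input $x$, whether the trajectory of $M$ on $x$ is eventually periodic. Precisely: there is no Turing machine $E$ with input alphabet $\{0,1\}$ such that, for every Turing machine $M$ (with numbered sets as above) and every input word $x$ of $M$, $E$ halts on $\langle M,x\rangle$ in its accepting state if the trajectory of $M$ on $x$ is eventually periodic, and halts on $\langle M,x\rangle$ in its rejecting state if it is not. -/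

import Mathlib

/-- A deterministic one-tape Turing machine with finite set of states `Q`, finite input alphabet `A`
and finite tape alphabet `Γ`. The input alphabet is regarded as a subset of the tape alphabet,
not containing the blank symbol, through the injection `letter`. -/
structure TuringMachine (Q A Γ : Type*) [Finite Q] [Finite A] [Finite Γ] where
  /-- The blank symbol. -/
  blank : Γ
  /-- The inclusion of the input alphabet into the tape alphabet. -/
  letter : A ↪ Γ
  letter_ne_blank : ∀ a, letter a ≠ blank
  /-- The transition function: new state, symbol written, direction of the move. -/
  δ : Q → Γ → Q × Γ × Turing.Dir
  /-- The start state. -/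
  start : Q
  /-- The accepting halting state. -/
  accept : Q
  /-- The rejecting halting state. -/
  reject : Q
  accept_ne_reject : accept ≠ reject

namespace TuringMachine

/-- A configuration: current state, contents of the (one-way infinite) tape, position of the
head. -/
@[ext]
structure Config (Q Γ : Type*) where
  state : Q
  tape : ℕ → Γ
  head : ℕ

section Run

variable {Q A Γ : Type*} [Finite Q] [Finite A] [Finite Γ]

/-- The new position of the head. A head on the leftmost cell that tries to move left stays. -/
def moveHead (i : ℕ) : Turing.Dir → ℕ
  | Turing.Dir.left => i - 1
  | Turing.Dir.right => i + 1

/-- The configuration obtained from `c` by applying the transition function once. -/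
def next (M : TuringMachine Q A Γ) (c : Config Q Γ) : Config Q Γ where
  state := (M.δ c.state (c.tape c.head)).1
  tape := Function.update c.tape c.head (M.δ c.state (c.tape c.head)).2.1
  head := moveHead c.head (M.δ c.state (c.tape c.head)).2.2

open Classical in
/-- One step of the computation: there is none once the machine is in a halting state. -/
noncomputable def step (M : TuringMachine Q A Γ) (c : Config Q Γ) : Option (Config Q Γ) :=
  if c.state = M.accept ∨ c.state = M.reject then none else some (M.next c)

/-- The initial configuration on the input word `x`: start state, `x` on the leftmost cells and
blanks elsewhere, head on the leftmost cell. -/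
def init (M : TuringMachine Q A Γ) (x : List A) : Config Q Γ where
  state := M.start
  tape := fun i => (x[i]?).elim M.blank M.letter
  head := 0

/-- The trajectory of `M` on `x`: the configuration at each time `t`, or `none` if the machine has
halted before time `t`. -/
noncomputable def trajectory (M : TuringMachine Q A Γ) (x : List A) : ℕ → Option (Config Q Γ)
  | 0 => some (M.init x)
  | t + 1 => (M.trajectory x t).bind M.step

/-- The trajectory of `M` on `x` is eventually periodic: the machine returns to a configuration
visited at an earlier time. -/
def EventuallyPeriodic (M : TuringMachine Q A Γ) (x : List A) : Prop :=
  ∃ (s t : ℕ) (c : Config Q Γ), s < t ∧ M.trajectory x s = some c ∧ M.trajectory x t = some c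

/-- `M` halts on `x` in the accepting state. -/
def Accepts (M : TuringMachine Q A Γ) (x : List A) : Prop :=
  ∃ (t : ℕ) (c : Config Q Γ), M.trajectory x t = some c ∧ c.state = M.accept

/-- `M` halts on `x` in the rejecting state. -/
def Rejects (M : TuringMachine Q A Γ) (x : List A) : Prop :=
  ∃ (t : ℕ) (c : Config Q Γ), M.trajectory x t = some c ∧ c.state = M.reject

end Run

section Encoding

/-- A list of natural numbers as a binary word: each number `k` becomes `k` ones and a zero. -/
def encodeNats (l : List ℕ) : List Bool :=
  l.flatMap fun k => List.replicate k true ++ [false]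

variable {n k m : ℕ}

/-- The number of a direction: `0` for left and `1` for right. -/
def dirNum : Turing.Dir → ℕ
  | Turing.Dir.left => 0
  | Turing.Dir.right => 1

/-- The row of the transition table for state `q` and scanned symbol `a`. -/
def entry (M : TuringMachine (Fin n) (Fin k) (Fin m)) (q : Fin n) (a : Fin m) : List ℕ :=
  [((M.δ q a).1 : ℕ), ((M.δ q a).2.1 : ℕ), dirNum (M.δ q a).2.2]

/-- The complete description of a machine by a list of natural numbers: the sizes of its three
sets, its distinguished states and blank, the inclusion of its input alphabet, and its
transition table. -/
def description (M : TuringMachine (Fin n) (Fin k) (Fin m)) : List ℕ :=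
  [n, k, m, (M.start : ℕ), (M.accept : ℕ), (M.reject : ℕ), (M.blank : ℕ)] ++
    (List.finRange k).map (fun a : Fin k => (M.letter a).val) ++
    (List.finRange n).flatMap fun q => (List.finRange m).flatMap fun a => M.entry q a

/-- The binary encoding `⟨M, x⟩` of a machine and an input word. -/
def encode (M : TuringMachine (Fin n) (Fin k) (Fin m)) (x : List (Fin k)) : List Bool :=
  encodeNats (M.description ++ x.map Fin.val)

end Encoding

theorem encodeNats_injective : Function.Injective encodeNats := by
  have key : ∀ (a b : ℕ) (u v : List Bool),
      List.replicate a true ++ (false :: u) = List.replicate b true ++ (false :: v) →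
        a = b ∧ u = v := by
    intro a
    induction a with
    | zero =>
      intro b u v h
      cases b with
      | zero => simpa using h
      | succ b => simp [List.replicate_succ] at h
    | succ a ih =>
      intro b u v h
      cases b with
      | zero => simp [List.replicate_succ] at h
      | succ b =>
        simp only [List.replicate_succ, List.cons_append, List.cons.injEq, true_and] at h
        obtain ⟨h1, h2⟩ := ih b u v h
        exact ⟨by rw [h1], h2⟩
  intro l
  induction l with
  | nil =>
    intro l' h
    cases l' with
    | nil => rfl
    | cons b l' => simp [encodeNats] at h
  | cons a l ih =>
    intro l' h
    cases l' with
    | nil => simp [encodeNats] at h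
    | cons b l' =>
      simp only [encodeNats, List.flatMap_cons, List.append_assoc, List.cons_append,
        List.nil_append] at h
      obtain ⟨h1, h2⟩ := key _ _ _ _ h
      rw [h1, ih h2]

theorem eq_of_flatMap_eq {α β : Type*} {f g : α → List β} (hl : ∀ a, (f a).length = (g a).length) :
    ∀ l : List α, l.flatMap f = l.flatMap g → ∀ a ∈ l, f a = g a := by
  intro l
  induction l with
  | nil => simp
  | cons b l ih =>
    intro h
    simp only [List.flatMap_cons] at h
    obtain ⟨h1, h2⟩ := List.append_inj h (hl b)
    intro a ha
    rcases List.mem_cons.1 ha with rfl | ha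
    · exact h1
    · exact ih h2 a ha

/-- The encoding is faithful: a machine and an input can be recovered from it. -/
theorem encode_injective :
    Function.Injective
      (fun p : (Σ n k m : ℕ, TuringMachine (Fin n) (Fin k) (Fin m) × List (Fin k)) =>
        encode p.2.2.2.1 p.2.2.2.2) := by
  rintro ⟨n, k, m, M, x⟩ ⟨n', k', m', M', x'⟩ h
  have h := encodeNats_injective h
  simp only [description, List.cons_append, List.nil_append, List.cons.injEq,
    List.append_assoc] at h
  obtain ⟨rfl, rfl, rfl, h1, h2, h3, h4, h⟩ := h
  obtain ⟨h5, h⟩ := List.append_inj h (by simp)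
  obtain ⟨h6, h7⟩ := List.append_inj h (by simp [entry, List.length_flatMap])
  have hx : x = x' := (List.map_injective_iff.2 Fin.val_injective) h7
  have hδ : M.δ = M'.δ := by
    funext q a
    have e := eq_of_flatMap_eq (by simp [entry, List.length_flatMap]) _ h6 q (List.mem_finRange q)
    have e := eq_of_flatMap_eq (by simp [entry]) _ e a (List.mem_finRange a)
    simp only [entry, List.cons.injEq, and_true] at e
    obtain ⟨e1, e2, e3⟩ := e
    refine Prod.ext (Fin.ext e1) (Prod.ext (Fin.ext e2) ?_)
    generalize (M.δ q a).2.2 = d at e3 ⊢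
    generalize (M'.δ q a).2.2 = d' at e3 ⊢
    cases d <;> cases d' <;> simp_all [dirNum]
  have hL : M.letter = M'.letter := by
    ext a
    exact (List.map_inj_left.1 h5) a (List.mem_finRange a)
  have hM : M = M' := by
    cases M
    cases M'
    simp only [Fin.val_inj] at h1 h2 h3 h4
    simp_all
  rw [hM, hx]

end TuringMachine

/-! Diagonalization, by a machine that runs a supposed decider `E` on its own code. The encoding of
a machine with an input is the code of the description followed by the codes of the letters. So for
the input alphabet `{0,1}`, if `x` is the code of the description of `D`, then `⟨D, x⟩` is `x`
followed by the code of `x`: a machine computes it from its input alone, with no recursion theorem.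
`diagonal` does this (`reaches_init_append`) and then simulates `E` (`Reaches.diagonal`). If `E`
accepts, it halts, so its trajectory is not eventually periodic; if `E` rejects, it walks to the
first cell and repeats one configuration forever (`reaches_head_zero`, `step_diagonal_eq_self`).
Either answer of `E` is wrong. -/

namespace TuringMachine

/-! ### Reachability, halting and periodicity -/

section Reachability

variable {Q A Γ : Type*} [Finite Q] [Finite A] [Finite Γ]

/-- `c'` is reached from `c` in finitely many steps. -/
def Reaches (M : TuringMachine Q A Γ) : Config Q Γ → Config Q Γ → Prop :=
  Relation.ReflTransGen fun c c' => M.step c = some c'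

theorem Reaches.trans {M : TuringMachine Q A Γ} {c d e : Config Q Γ} (h : M.Reaches c d)
    (h' : M.Reaches d e) : M.Reaches c e :=
  Relation.ReflTransGen.trans h h'

theorem step_eq_next {M : TuringMachine Q A Γ} {c : Config Q Γ} (ha : c.state ≠ M.accept)
    (hr : c.state ≠ M.reject) : M.step c = some (M.next c) := by
  simp [step, ha, hr]

theorem Reaches.exists_trajectory_eq {M : TuringMachine Q A Γ} {x : List A} {c : Config Q Γ}
    (h : M.Reaches (M.init x) c) : ∃ t, M.trajectory x t = some c := by
  induction h with
  | refl => exact ⟨0, rfl⟩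
  | tail _ h ih =>
    obtain ⟨t, ht⟩ := ih
    exact ⟨t + 1, by simp [trajectory, ht, h]⟩

theorem reaches_of_trajectory_eq {M : TuringMachine Q A Γ} {x : List A} {t : ℕ} {c : Config Q Γ}
    (h : M.trajectory x t = some c) : M.Reaches (M.init x) c := by
  induction t generalizing c with
  | zero =>
    cases h
    exact .refl
  | succ t ih =>
    obtain ⟨c', h1, h2⟩ := Option.bind_eq_some_iff.1 h
    exact (ih h1).tail h2

theorem eventuallyPeriodic_of_step_eq_self {M : TuringMachine Q A Γ} {x : List A} {c : Config Q Γ}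
    (h : M.Reaches (M.init x) c) (hc : M.step c = some c) : M.EventuallyPeriodic x := by
  obtain ⟨t, ht⟩ := h.exists_trajectory_eq
  exact ⟨t, t + 1, c, t.lt_succ_self, ht, by simp [trajectory, ht, hc]⟩

theorem trajectory_add {M : TuringMachine Q A Γ} {x : List A} {s t : ℕ}
    (h : M.trajectory x s = M.trajectory x t) (r : ℕ) :
    M.trajectory x (s + r) = M.trajectory x (t + r) := by
  induction r with
  | zero => exact h
  | succ r ih => exact congrArg (fun o => o.bind M.step) ih

theorem trajectory_eq_none_of_le {M : TuringMachine Q A Γ} {x : List A} {s t : ℕ}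
    (h : M.trajectory x s = none) (hst : s ≤ t) : M.trajectory x t = none := by
  induction t, hst using Nat.le_induction with
  | base => exact h
  | succ t _ ih => simp [trajectory, ih]

/-- A machine that halts does not have an eventually periodic trajectory. -/
theorem not_eventuallyPeriodic_of_step_eq_none {M : TuringMachine Q A Γ} {x : List A}
    {c : Config Q Γ} (h : M.Reaches (M.init x) c) (hc : M.step c = none) :
    ¬ M.EventuallyPeriodic x := by
  rintro ⟨s, t, d, hst, hs, ht⟩
  obtain ⟨u, hu⟩ := h.exists_trajectory_eq
  have hnone : M.trajectory x (u + 1) = none := by simp [trajectory, hu, hc]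
  -- From time `s` on, the trajectory repeats with period `t - s`, so it never ends.
  have key : ∀ r, M.trajectory x (s + r) ≠ none := by
    intro r
    induction r using Nat.strong_induction_on with
    | _ r ih =>
      rcases lt_or_ge r (t - s) with hr | hr
      · intro h0
        have := trajectory_eq_none_of_le h0 (show s + r ≤ t by omega)
        simp [ht] at this
      · have := trajectory_add (hs.trans ht.symm) (r - (t - s))
        rw [show t + (r - (t - s)) = s + r by omega] at this
        rw [← this]
        exact ih _ (by omega)
  exact key (u + 1) (trajectory_eq_none_of_le hnone (by omega))

end Reachability

/-! ### Simulation and renaming of machines -/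

section Simulation

variable {Q A Γ Q' A' Γ' : Type*} [Finite Q] [Finite A] [Finite Γ]
  [Finite Q'] [Finite A'] [Finite Γ']

/-- Rename the states and the tape symbols of a configuration. -/
def Config.map {Q Γ Q' Γ' : Type*} (g : Q → Q') (h : Γ → Γ') (c : Config Q Γ) : Config Q' Γ' where
  state := g c.state
  tape := h ∘ c.tape
  head := c.head

/-- A machine whose transition function extends that of `M` simulates the runs of `M`. -/
theorem Reaches.map {M : TuringMachine Q A Γ} {M' : TuringMachine Q' A' Γ'} {g : Q → Q'}
    {h : Γ → Γ'}
    (hg : ∀ q, q ≠ M.accept → q ≠ M.reject → g q ≠ M'.accept ∧ g q ≠ M'.reject)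
    (hδ : ∀ q a, q ≠ M.accept → q ≠ M.reject →
      M'.δ (g q) (h a) = (g (M.δ q a).1, h (M.δ q a).2.1, (M.δ q a).2.2))
    {c c' : Config Q Γ} (H : M.Reaches c c') : M'.Reaches (c.map g h) (c'.map g h) := by
  refine Relation.ReflTransGen.lift (Config.map g h) (fun c c' hc => ?_) _ _ H
  -- No step leaves a halting state, so the transitions need not agree there; this leaves `diagonal`
  -- free to change what happens where `E` rejects.
  by_cases hh : c.state = M.accept ∨ c.state = M.reject
  · simp [step, hh] at hc
  · obtain ⟨ha, hr⟩ := not_or.1 hh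
    rw [step_eq_next ha hr, Option.some_inj] at hc
    change M'.step (c.map g h) = some (c'.map g h)
    rw [step_eq_next (c := c.map g h) (hg _ ha hr).1 (hg _ ha hr).2, Option.some_inj, ← hc]
    have := hδ c.state (c.tape c.head) ha hr
    simp [next, Config.map, this, Function.comp_update]

/-- Rename the states, the letters and the tape symbols of a machine. -/
def reindex (M : TuringMachine Q A Γ) (eQ : Q ≃ Q') (eA : A ≃ A') (eΓ : Γ ≃ Γ') :
    TuringMachine Q' A' Γ' where
  blank := eΓ M.blank
  letter := (eA.symm.toEmbedding.trans M.letter).trans eΓ.toEmbedding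
  letter_ne_blank a := by simpa using M.letter_ne_blank (eA.symm a)
  δ q a := (eQ (M.δ (eQ.symm q) (eΓ.symm a)).1, eΓ (M.δ (eQ.symm q) (eΓ.symm a)).2.1,
    (M.δ (eQ.symm q) (eΓ.symm a)).2.2)
  start := eQ M.start
  accept := eQ M.accept
  reject := eQ M.reject
  accept_ne_reject := by simpa using M.accept_ne_reject

theorem init_reindex (M : TuringMachine Q A Γ) (eQ : Q ≃ Q') (eA : A ≃ A') (eΓ : Γ ≃ Γ')
    (x : List A) : (M.reindex eQ eA eΓ).init (x.map eA) = (M.init x).map eQ eΓ := by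
  simp only [init, Config.map, reindex, Config.mk.injEq, and_true, true_and]
  funext i
  cases h : x[i]? <;> simp [h]

theorem Reaches.reindex {M : TuringMachine Q A Γ} {x : List A} {c : Config Q Γ}
    (h : M.Reaches (M.init x) c) (eQ : Q ≃ Q') (eA : A ≃ A') (eΓ : Γ ≃ Γ') :
    (M.reindex eQ eA eΓ).Reaches ((M.reindex eQ eA eΓ).init (x.map eA)) (c.map eQ eΓ) := by
  rw [init_reindex]
  exact h.map (by simp +contextual [TuringMachine.reindex]) (by simp [TuringMachine.reindex])

end Simulation

/-! ### Head movements on finite words -/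

section Sweep

variable {Q A Γ : Type*} [Finite Q] [Finite A] [Finite Γ] (M : TuringMachine Q A Γ)

/-- The tape that holds the word `w` followed by blanks. -/
def tapeOf (w : List Γ) (i : ℕ) : Γ := w[i]?.getD M.blank

/-- The tape holds `l.reverse ++ r`, and the head is on the first cell of `r`. -/
def rightOf (q : Q) (l r : List Γ) : Config Q Γ := ⟨q, M.tapeOf (l.reverse ++ r), l.length⟩

/-- The tape holds `l.reverse ++ r`, and the head is on the last cell before `r`, if there is
one. -/
def leftOf (q : Q) (l r : List Γ) : Config Q Γ := ⟨q, M.tapeOf (l.reverse ++ r), l.length - 1⟩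

variable {M}

theorem leftOf_cons (q : Q) (a : Γ) (l r : List Γ) :
    M.leftOf q (a :: l) r = M.rightOf q l (a :: r) := by
  simp [leftOf, rightOf]

/-- Exposes the blank under a head that has run past the written word, so that `reaches_right` and
`reaches_left` apply there. -/
theorem rightOf_nil_right (q : Q) (l : List Γ) : M.rightOf q l [] = M.rightOf q l [M.blank] := by
  simp only [rightOf, Config.mk.injEq, and_true, true_and]
  funext i
  simp only [tapeOf, List.append_nil]
  rcases lt_trichotomy i l.reverse.length with h | h | h
  · rw [List.getElem?_append_left h]
  · subst h
    simp
  · rw [List.getElem?_eq_none h.le, List.getElem?_eq_none (by simp at h ⊢; omega)]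

theorem update_tapeOf (l r : List Γ) (a b : Γ) :
    Function.update (M.tapeOf (l.reverse ++ a :: r)) l.length b =
      M.tapeOf (l.reverse ++ b :: r) := by
  funext i
  rcases eq_or_ne i l.length with rfl | h
  · simp [tapeOf]
  · rw [Function.update_of_ne h]
    simp only [tapeOf, List.getElem?_append, List.length_reverse]
    split_ifs with h'
    · rfl
    · obtain ⟨j, hj⟩ : ∃ j, i - l.length = j + 1 := ⟨i - l.length - 1, by omega⟩
      simp [hj]

theorem next_rightOf (q : Q) (l r : List Γ) (a : Γ) :
    M.next (M.rightOf q l (a :: r)) =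
      ⟨(M.δ q a).1, M.tapeOf (l.reverse ++ (M.δ q a).2.1 :: r),
        moveHead l.length (M.δ q a).2.2⟩ := by
  have h : M.tapeOf (l.reverse ++ a :: r) l.length = a := by simp [tapeOf]
  simp [next, rightOf, h, update_tapeOf]

theorem reaches_right {q q' : Q} {a b : Γ} (ha : q ≠ M.accept) (hr : q ≠ M.reject)
    (h : M.δ q a = (q', b, Turing.Dir.right)) (l r : List Γ) :
    M.Reaches (M.rightOf q l (a :: r)) (M.rightOf q' (b :: l) r) := by
  refine .single ?_
  rw [step_eq_next (by exact ha) (by exact hr), next_rightOf, h]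
  simp [rightOf, moveHead]

/-- Covers `l = []` as well: the truncated subtractions in `leftOf` and `moveHead` both keep the
head on the first cell. -/
theorem reaches_left {q q' : Q} {a b : Γ} (ha : q ≠ M.accept) (hr : q ≠ M.reject)
    (h : M.δ q a = (q', b, Turing.Dir.left)) (l r : List Γ) :
    M.Reaches (M.rightOf q l (a :: r)) (M.leftOf q' l (b :: r)) := by
  refine .single ?_
  rw [step_eq_next (by exact ha) (by exact hr), next_rightOf, h]
  simp [leftOf, moveHead]

theorem reaches_sweep_right {q : Q} (ha : q ≠ M.accept) (hr : q ≠ M.reject) {w : List Γ}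
    (h : ∀ a ∈ w, M.δ q a = (q, a, Turing.Dir.right)) (l r : List Γ) :
    M.Reaches (M.rightOf q l (w ++ r)) (M.rightOf q (w.reverse ++ l) r) := by
  induction w generalizing l with
  | nil => exact .refl
  | cons a w ih =>
    refine Reaches.trans (reaches_right ha hr (h a (by simp)) l (w ++ r)) ?_
    simpa using ih (fun b hb => h b (by simp [hb])) (a :: l)

theorem reaches_sweep_left {q : Q} (ha : q ≠ M.accept) (hr : q ≠ M.reject) {w : List Γ}
    (h : ∀ a ∈ w, M.δ q a = (q, a, Turing.Dir.left)) (l r : List Γ) :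
    M.Reaches (M.leftOf q (w ++ l) r) (M.leftOf q l (w.reverse ++ r)) := by
  induction w generalizing r with
  | nil => exact .refl
  | cons a w ih =>
    rw [List.cons_append, leftOf_cons]
    refine Reaches.trans (reaches_left ha hr (h a (by simp)) (w ++ l) r) ?_
    simpa using ih (fun b hb => h b (by simp [hb])) (a :: r)

end Sweep

/-! ### The diagonal machine -/

section Diagonal

/-- The states of the part of the diagonal machine that prepares the tape. -/
inductive CopyState
  | begin
  | fetch
  | emit (b : Bool)
  | seekUnread
  | seekRead
  | dead
  deriving Fintype

open CopyState

variable {Q Γ : Type*} [Finite Q] [Finite Γ]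

open Classical in
/-- The transition function of the diagonal machine. The tape symbols `inr (some b)` are input
letters that have not been copied yet, and `inr none` marks the first cell. -/
noncomputable def diagonalδ (E : TuringMachine Q Bool Γ) :
    Q ⊕ CopyState → Γ ⊕ Option Bool → (Q ⊕ CopyState) × (Γ ⊕ Option Bool) × Turing.Dir
  | .inl q, .inl a =>
    if q = E.reject then (.inl q, .inl a, .left)
    else (.inl (E.δ q a).1, .inl (E.δ q a).2.1, (E.δ q a).2.2)
  | .inr begin, _ => (.inr (emit true), .inr none, .right)
  | .inr fetch, .inr (some b) => (.inr (emit b), .inl (E.letter b), .right)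
  | .inr (emit b), .inl a =>
    if a = E.blank then
      if b then (.inr (emit false), .inl (E.letter true), .right)
      else (.inr seekUnread, .inl (E.letter false), .left)
    else (.inr (emit b), .inl a, .right)
  | .inr (emit b), .inr s => (.inr (emit b), .inr s, .right)
  | .inr seekUnread, .inl a => (.inr seekUnread, .inl a, .left)
  | .inr seekUnread, .inr (some b) => (.inr seekRead, .inr (some b), .left)
  -- Everything is copied. The marker gives way to the letter `true` that it replaced (only inputs
  -- beginning with `true` matter), and the left move keeps the head on the first cell, where `E`
  -- starts.
  | .inr seekUnread, .inr none => (.inl E.start, .inl (E.letter true), .left)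
  | .inr seekRead, .inr (some b) => (.inr seekRead, .inr (some b), .left)
  | .inr seekRead, .inl a => (.inr fetch, .inl a, .right)
  | .inr seekRead, .inr none => (.inr fetch, .inr none, .right)
  | q, a => (q, a, .left)

/-- The machine that appends to its input `x` the binary encoding of the letters of `x`, and then
runs `E` on the result, except that it loops where `E` rejects. -/
noncomputable def diagonal (E : TuringMachine Q Bool Γ) :
    TuringMachine (Q ⊕ CopyState) Bool (Γ ⊕ Option Bool) where
  blank := .inl E.blank
  letter := ⟨fun b => .inr (some b), fun a b h => by simpa using h⟩
  letter_ne_blank a := by simp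
  δ := E.diagonalδ
  start := .inr begin
  accept := .inl E.accept
  reject := .inr dead
  accept_ne_reject := by simp

/-- The binary encoding of a letter of the alphabet `{0, 1}`. -/
def codeBit (b : Bool) : List Bool := List.replicate b.toNat true ++ [false]

variable (E : TuringMachine Q Bool Γ)

/-- A word over the input alphabet of `E` as a word over the tape alphabet of `E.diagonal`. -/
def written (w : List Bool) : List (Γ ⊕ Option Bool) := w.map fun b => .inl (E.letter b)

/-- A word of input letters of `E.diagonal` that have not been copied yet. -/
def unread (w : List Bool) : List (Γ ⊕ Option Bool) := w.map fun b => .inr (some b)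

variable {E}

theorem diagonalδ_emit_written (b b' : Bool) :
    E.diagonalδ (.inr (emit b)) (.inl (E.letter b')) =
      (.inr (emit b), .inl (E.letter b'), .right) := by
  simp [diagonalδ, E.letter_ne_blank]

theorem reaches_emit_nil (b : Bool) (l : List (Γ ⊕ Option Bool)) :
    E.diagonal.Reaches (E.diagonal.rightOf (.inr (emit b)) l [])
      (E.diagonal.leftOf (.inr seekUnread) l (E.written (codeBit b))) := by
  have hfalse : ∀ l, E.diagonal.Reaches (E.diagonal.rightOf (.inr (emit false)) l [])
      (E.diagonal.leftOf (.inr seekUnread) l [.inl (E.letter false)]) := fun l => by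
    rw [rightOf_nil_right]
    exact reaches_left (by simp [diagonal]) (by simp [diagonal])
      (by simp [diagonal, diagonalδ]) l []
  cases b with
  | false => exact hfalse l
  | true =>
    have h1 : E.diagonal.Reaches (E.diagonal.rightOf (.inr (emit true)) l [])
        (E.diagonal.rightOf (.inr (emit false)) (.inl (E.letter true) :: l) []) := by
      rw [rightOf_nil_right]
      exact reaches_right (by simp [diagonal]) (by simp [diagonal])
        (by simp [diagonal, diagonalδ]) l []
    refine (h1.trans (hfalse _)).trans ?_
    rw [leftOf_cons]
    exact reaches_left (by simp [diagonal]) (by simp [diagonal]) rfl l _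

/-- One copying round: sweep right to the first blank, append the code of `b`, sweep back over the
output `o`. -/
theorem reaches_emit (b : Bool) (l : List (Γ ⊕ Option Bool)) (u o : List Bool) :
    E.diagonal.Reaches (E.diagonal.rightOf (.inr (emit b)) l (unread u ++ E.written o))
      (E.diagonal.leftOf (.inr seekUnread) ((unread u).reverse ++ l)
        (E.written (o ++ codeBit b))) := by
  have h1 := reaches_sweep_right (M := E.diagonal) (q := .inr (emit b)) (by simp [diagonal])
    (by simp [diagonal]) (w := unread u ++ E.written o) (by
      intro a ha
      rcases List.mem_append.1 ha with ha | ha <;> obtain ⟨b', -, rfl⟩ := List.mem_map.1 ha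
      · rfl
      · exact diagonalδ_emit_written b b') l []
  have h2 := reaches_sweep_left (M := E.diagonal) (q := .inr seekUnread) (by simp [diagonal])
    (by simp [diagonal]) (w := (E.written o).reverse) (by
      intro a ha
      obtain ⟨b', -, rfl⟩ := List.mem_map.1 (List.mem_reverse.1 ha)
      rfl) ((unread u).reverse ++ l) (E.written (codeBit b))
  rw [List.append_nil] at h1
  refine h1.trans ((reaches_emit_nil b _).trans ?_)
  simpa [written] using h2

/-- The head returns from the end of the tape to the first letter that has not been copied. -/
theorem reaches_fetch (b : Bool) (u o p : List Bool) :
    E.diagonal.Reaches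
      (E.diagonal.leftOf (.inr seekUnread)
        ((unread (b :: u)).reverse ++ ((E.written p).reverse ++ [.inr none])) (E.written o))
      (E.diagonal.rightOf (.inr fetch) ((E.written p).reverse ++ [.inr none])
        (unread (b :: u) ++ E.written o)) := by
  generalize hP : (E.written p).reverse ++ [Sum.inr none] = P
  -- The cell before the unread block holds the marker if `p` is empty and a copied letter
  -- otherwise; both turn `seekRead` into `fetch`.
  obtain ⟨d, P', rfl, hd⟩ : ∃ d P', P = d :: P' ∧
      E.diagonalδ (.inr seekRead) d = (.inr fetch, d, .right) := by
    rw [← hP]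
    rcases List.eq_nil_or_concat p with rfl | ⟨p', c, rfl⟩
    · exact ⟨_, [], rfl, rfl⟩
    · exact ⟨.inl (E.letter c), (E.written p').reverse ++ [.inr none], by simp [written], rfl⟩
  obtain ⟨c, w, hw⟩ : ∃ c w, (b :: u).reverse = c :: w :=
    List.exists_cons_of_ne_nil (by simp)
  have hu : b :: u = w.reverse ++ [c] := by
    rw [← List.reverse_reverse (b :: u), hw, List.reverse_cons]
  have h1 := reaches_left (M := E.diagonal) (q := .inr seekUnread) (a := .inr (some c))
    (by simp [diagonal]) (by simp [diagonal]) rfl (unread w ++ d :: P') (E.written o)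
  have h2 := reaches_sweep_left (M := E.diagonal) (q := .inr seekRead) (by simp [diagonal])
    (by simp [diagonal]) (w := unread w) (by
      intro a ha
      obtain ⟨b', -, rfl⟩ := List.mem_map.1 ha
      rfl) (d :: P') (.inr (some c) :: E.written o)
  have h3 := reaches_right (M := E.diagonal) (q := .inr seekRead) (by simp [diagonal])
    (by simp [diagonal]) hd P' ((unread w).reverse ++ .inr (some c) :: E.written o)
  rw [← leftOf_cons] at h1 h3
  have h := (h1.trans h2).trans h3
  rw [hu]
  simpa [unread] using h

/-- The loop invariant of the copying: after the marker come the copied letters `p`, the unread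
letters `u` and the output `o`. A round moves the first letter of `u` to the end of `p` and its code
to the end of `o`. -/
theorem reaches_copied (u o p : List Bool) :
    E.diagonal.Reaches
      (E.diagonal.leftOf (.inr seekUnread)
        ((unread u).reverse ++ ((E.written p).reverse ++ [.inr none])) (E.written o))
      (E.diagonal.rightOf (.inl E.start) []
        (E.written (true :: (p ++ u ++ o ++ u.flatMap codeBit)))) := by
  induction u generalizing o p with
  | nil =>
    have h1 := reaches_sweep_left (M := E.diagonal) (q := .inr seekUnread) (by simp [diagonal])
      (by simp [diagonal]) (w := (E.written p).reverse) (by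
        intro a ha
        obtain ⟨b', -, rfl⟩ := List.mem_map.1 (List.mem_reverse.1 ha)
        rfl) [.inr none] (E.written o)
    refine Reaches.trans h1 ?_
    rw [leftOf_cons]
    have h2 := reaches_left (M := E.diagonal) (q := .inr seekUnread) (a := .inr none)
      (by simp [diagonal]) (by simp [diagonal]) rfl [] (E.written p ++ E.written o)
    simpa [written, leftOf, rightOf] using h2
  | cons b u ih =>
    have h1 := reaches_right (M := E.diagonal) (q := .inr fetch) (a := .inr (some b))
      (by simp [diagonal]) (by simp [diagonal]) rfl ((E.written p).reverse ++ [.inr none])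
      (unread u ++ E.written o)
    have h2 := ih (o ++ codeBit b) (p ++ [b])
    have h3 := reaches_emit (E := E) b
      (.inl (E.letter b) :: ((E.written p).reverse ++ [.inr none])) u o
    refine ((reaches_fetch b u o p).trans h1).trans (h3.trans ?_)
    simpa [written] using h2

theorem init_eq_rightOf (x : List Bool) :
    E.diagonal.init x = E.diagonal.rightOf (.inr begin) [] (unread x) := by
  simp only [init, rightOf, diagonal, Config.mk.injEq, List.length_nil, and_true, true_and]
  funext i
  cases h : x[i]? with
  | none => simp [tapeOf, unread, h]
  | some b =>
    simp [tapeOf, unread, h]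
    rfl

theorem rightOf_written (x : List Bool) :
    E.diagonal.rightOf (.inl E.start) [] (E.written x) = (E.init x).map .inl .inl := by
  simp only [init, rightOf, Config.map, Config.mk.injEq, List.length_nil, and_true, true_and]
  funext i
  cases h : x[i]? <;> simp [tapeOf, written, h, diagonal]

/-- The diagonal machine starts `E` on its own input followed by the code of this input. -/
theorem reaches_init_append (y : List Bool) :
    E.diagonal.Reaches (E.diagonal.init (true :: y))
      ((E.init (true :: y ++ (true :: y).flatMap codeBit)).map .inl .inl) := by
  rw [init_eq_rightOf, ← rightOf_written]
  -- The marker overwrites the first letter, whose code is emitted at once; hence the copying loop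
  -- starts with output `codeBit true`.
  have h1 := reaches_right (M := E.diagonal) (q := .inr begin) (a := .inr (some true))
    (by simp [diagonal]) (by simp [diagonal]) rfl [] (unread y)
  have h2 := reaches_emit (E := E) true [.inr none] y []
  have h3 := reaches_copied (E := E) y (codeBit true) []
  simp only [written, List.map_nil, List.append_nil, List.nil_append, List.reverse_nil] at h1 h2 h3
  simpa [written, unread] using h1.trans (h2.trans h3)

/-- The diagonal machine simulates `E`. -/
theorem Reaches.diagonal {c c' : Config Q Γ} (h : E.Reaches c c') :
    E.diagonal.Reaches (c.map .inl .inl) (c'.map .inl .inl) :=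
  h.map (by simp +contextual [TuringMachine.diagonal])
    (fun q a _ hr => by simp [TuringMachine.diagonal, diagonalδ, hr])

/-- Where `E` rejects, the diagonal machine moves to the left end of the tape. -/
theorem reaches_head_zero (c : Config Q Γ) (h : c.state = E.reject) :
    E.diagonal.Reaches (c.map .inl .inl) (Config.map .inl .inl { c with head := 0 }) := by
  obtain ⟨q, w, i⟩ := c
  subst h
  induction i with
  | zero => exact .refl
  | succ i ih =>
    refine Reaches.trans (.single ?_) ih
    rw [step_eq_next (by simp [Config.map, TuringMachine.diagonal, E.accept_ne_reject.symm])
      (by simp [Config.map, TuringMachine.diagonal])]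
    simp [next, Config.map, TuringMachine.diagonal, diagonalδ, moveHead]

/-- The symbol is rewritten unchanged, and a left move from the first cell stays in place. -/
theorem step_diagonal_eq_self (w : ℕ → Γ) :
    E.diagonal.step (Config.map .inl .inl ⟨E.reject, w, 0⟩) =
      some (Config.map .inl .inl ⟨E.reject, w, 0⟩) := by
  rw [step_eq_next (by simp [Config.map, TuringMachine.diagonal, E.accept_ne_reject.symm])
    (by simp [Config.map, TuringMachine.diagonal])]
  simp [next, Config.map, TuringMachine.diagonal, diagonalδ, moveHead]

end Diagonal

/-! ### Numbered machines and their codes -/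

section Reindexed

variable {Q A Γ Q' A' Γ' : Type*} [Finite Q] [Finite A] [Finite Γ]
  [Finite Q'] [Finite A'] [Finite Γ']

/-- An equality, including the value `none`, so halting is transferred too. -/
theorem step_reindex (M : TuringMachine Q A Γ) (eQ : Q ≃ Q') (eA : A ≃ A') (eΓ : Γ ≃ Γ')
    (c : Config Q Γ) :
    (M.reindex eQ eA eΓ).step (c.map eQ eΓ) = (M.step c).map (Config.map eQ eΓ) := by
  by_cases h : c.state = M.accept ∨ c.state = M.reject
  · simp [step, reindex, Config.map, h]
  · simp [step, reindex, Config.map, h, next, Function.comp_update]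

theorem encode_eq_append {n m : ℕ} (M : TuringMachine (Fin n) (Fin 2) (Fin m)) (x : List Bool) :
    encode M (x.map finTwoEquiv.symm) = encodeNats M.description ++ x.flatMap codeBit := by
  have h : ∀ b : Bool, (finTwoEquiv.symm b).val = b.toNat := by decide
  simp only [encode, encodeNats, List.flatMap_append, List.flatMap_map, h]
  rfl

/-- The description begins with the number of states, which is positive because there is a start
state. -/
theorem exists_encodeNats_description_eq {n k m : ℕ} (M : TuringMachine (Fin n) (Fin k) (Fin m)) :
    ∃ y, encodeNats M.description = true :: y := by
  obtain ⟨n, rfl⟩ := Nat.exists_eq_succ_of_ne_zero (Fin.pos M.start).ne'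
  simp [description, encodeNats, List.replicate_succ]

end Reindexed

/-- No machine decides whether trajectories are eventually periodic. -/
theorem not_decides_eventuallyPeriodic {Q Γ : Type*} [Finite Q] [Finite Γ]
    (E : TuringMachine Q Bool Γ) :
    ¬ ∀ (n k m : ℕ) (M : TuringMachine (Fin n) (Fin k) (Fin m)) (x : List (Fin k)),
      (M.EventuallyPeriodic x → E.Accepts (encode M x)) ∧
        (¬ M.EventuallyPeriodic x → E.Rejects (encode M x)) := by
  intro hE
  obtain ⟨n, ⟨eQ⟩⟩ := Finite.exists_equiv_fin (Q ⊕ CopyState)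
  obtain ⟨m, ⟨eΓ⟩⟩ := Finite.exists_equiv_fin (Γ ⊕ Option Bool)
  let D := E.diagonal.reindex eQ finTwoEquiv.symm eΓ
  obtain ⟨y, hy⟩ := D.exists_encodeNats_description_eq
  -- The input is the code of the description of `D` itself, so what `D` hands to `E` is exactly
  -- `⟨D, x⟩`.
  have hcode : encode D ((true :: y).map finTwoEquiv.symm) =
      true :: y ++ (true :: y).flatMap codeBit := by
    rw [encode_eq_append, hy]
  obtain ⟨hper, hnot⟩ := hE n 2 m D ((true :: y).map finTwoEquiv.symm)
  rw [hcode] at hper hnot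
  by_cases hD : D.EventuallyPeriodic ((true :: y).map finTwoEquiv.symm)
  -- `E` answers "periodic" by accepting, and then `D` halts.
  · obtain ⟨t, c, ht, hc⟩ := hper hD
    have hreach := (reaches_init_append y).trans (reaches_of_trajectory_eq ht).diagonal
    refine not_eventuallyPeriodic_of_step_eq_none (hreach.reindex eQ finTwoEquiv.symm eΓ) ?_ hD
    rw [step_reindex]
    simp [step, Config.map, diagonal, hc]
  -- `E` answers "not periodic" by rejecting, and then `D` reaches a fixed configuration.
  · obtain ⟨t, ⟨q, w, i⟩, ht, rfl⟩ := hnot hD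
    have hreach := ((reaches_init_append y).trans (reaches_of_trajectory_eq ht).diagonal).trans
      (reaches_head_zero _ rfl)
    refine hD (eventuallyPeriodic_of_step_eq_self
      (hreach.reindex eQ finTwoEquiv.symm eΓ) ?_)
    rw [step_reindex, step_diagonal_eq_self]
    rfl

end TuringMachine

theorem theorem1p1 :
    ¬ ∃ (Q Γ : Type) (_ : Finite Q) (_ : Finite Γ) (E : TuringMachine Q Bool Γ),
      ∀ (n k m : ℕ) (M : TuringMachine (Fin n) (Fin k) (Fin m)) (x : List (Fin k)),
        (M.EventuallyPeriodic x → E.Accepts (TuringMachine.encode M x)) ∧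
          (¬ M.EventuallyPeriodic x → E.Rejects (TuringMachine.encode M x)) := by
  rintro ⟨Q, Γ, _, _, E, hE⟩
  exact E.not_decides_eventuallyPeriodic hE
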